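/- All graphs are finite, simple and undirected. A graph is burned in rounds: in each round, every vertex adjacent to a vertex already on fire catches fire, and in addition one chosen vertex is lit (in the first round only the chosen vertex is lit). The burning number $b(G)$ is the least number of rounds after which all vertices of $G$ can be on fire, and a graph $G$ on $n$ vertices is called well-burnable if $b(G)\le\lceil\sqrt n\,\rceil$. A leaf of a tree is a vertex of degree $1$. For a tree $G$ with $n'\ge 1$ non-leaf vertices and for $k\ge 2$, let $p_k(G)$ be the number of vertices of degree $k$ divided by $n'$. Theorem 4.4. For every real $c>\frac13$ there is an $N$, depending only on $c$, such that every tree $G$ with at least $N$ non-leaf vertices and $$p_4(G)+2p_5(G)+3p_6(G)+\cdots\ \ge\ c$$ is well-burnable. (So, for any fixed concentrations $p_2,p_3,\dots$ with $p_4+2p_5+3p_6+\cdots>\frac13$, all trees with these concentrations and sufficiently many non-leaf vertices are well-burnable.) In particular, with the same $N$, every tree with at least $N$ non-leaf vertices in which, for some $k\ge4$, the fraction of non-leaf vertices that have degree at least $k$ is at least $\frac{c}{k-3}$ is well-burnable. (So, for any fixed $k\ge 4$ and any fixed $q>\frac1{3(k-3)}$, all trees with sufficiently many non-leaf vertices in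 which the fraction of non-leaf vertices of degree at least $k$ is at least $q$ are well-burnable.) -/

import Mathlib

namespace GraphBurning

/-- The set of vertices on fire after `t` rounds of burning, when `s i` is the vertex lit in
round `i + 1`. In each round the vertices already on fire spread the fire to all their neighbours,
and one further vertex is lit (in the first round nothing is on fire yet, so only `s 0` is lit). -/
def burned {V : Type*} (G : SimpleGraph V) (s : ℕ → V) : ℕ → Set V
  | 0 => ∅
  | t + 1 => burned G s t ∪ {v | ∃ u ∈ burned G s t, G.Adj u v} ∪ {s t}

/-- The burning number: the least number of rounds after which all vertices can be on fire.
The lit vertex is allowed to be on fire already; this does not change the minimum, since lighting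
a vertex that is not on fire instead can only enlarge the burned sets. -/
noncomputable def burningNumber {V : Type*} (G : SimpleGraph V) : ℕ :=
  sInf {m | ∃ s : ℕ → V, burned G s m = Set.univ}

/-- On a finite nonempty graph some burning process ends, so the infimum above is a minimum. -/
theorem exists_burned_eq_univ {V : Type*} [Finite V] [Nonempty V] (G : SimpleGraph V) :
    {m | ∃ s : ℕ → V, burned G s m = Set.univ}.Nonempty := by
  obtain ⟨n, ⟨e⟩⟩ := Finite.exists_equiv_fin V
  let s : ℕ → V := fun i => if h : i < n then e.symm ⟨i, h⟩ else Classical.arbitrary V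
  have mono : ∀ a t, a < t → s a ∈ burned G s t := by
    intro a t h
    induction t with
    | zero => omega
    | succ t ih =>
      rcases Nat.lt_succ_iff_lt_or_eq.mp h with h | rfl
      · exact Or.inl (Or.inl (ih h))
      · exact Or.inr rfl
  refine ⟨n, s, Set.eq_univ_of_forall fun v => ?_⟩
  have hv := mono (e v) n (e v).isLt
  simpa [s] using hv

/-- A graph on `n` vertices is well-burnable if its burning number is at most `⌈√n⌉`. -/
def WellBurnable {V : Type*} (G : SimpleGraph V) : Prop :=
  burningNumber G ≤ ⌈Real.sqrt (Nat.card V)⌉₊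

section Degrees

variable {V : Type*} [Fintype V] (G : SimpleGraph V) [DecidableRel G.Adj]

/-- The number of non-leaf vertices; a leaf is a vertex of degree `1`. -/
def numNonLeaf : ℕ := (Finset.univ.filter fun v => G.degree v ≠ 1).card

/-- The concentration `p_k` of vertices of degree `k` among the non-leaf vertices (for `k ≥ 2`). -/
noncomputable def conc (k : ℕ) : ℝ :=
  ((Finset.univ.filter fun v => G.degree v = k).card : ℝ) / numNonLeaf G

/-- The concentration of vertices of degree at least `k` among the non-leaf vertices
(for `k ≥ 2`). -/
noncomputable def concAtLeast (k : ℕ) : ℝ :=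
  ((Finset.univ.filter fun v => k ≤ G.degree v).card : ℝ) / numNonLeaf G

/-- The sum `p_4 + 2 p_5 + 3 p_6 + ⋯`; all degrees are less than the number of vertices. -/
noncomputable def excess : ℝ :=
  ∑ k ∈ Finset.Ico 4 (Fintype.card V), ((k : ℝ) - 3) * conc G k

end Degrees

end GraphBurning

namespace GraphBurning

/-! The degree condition enters only through the number of leaves: in a tree it forces at least `c *
n'` of them, so `n ≥ (1 + c) n'` with `1 + c > 4/3`. It therefore suffices to cover the `n'`
non-leaf vertices by balls of distinct radii below about `√n`, with radii to spare; raising each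
radius by one then covers the leaves.

Prune a rooted spanning tree from its deepest vertex. If no ball of radius `K` covers what is left,
then for each radius `x ≤ K` a ball of radius `x` covers a removable part, and these parts average
about `3 K / 4` vertices (`exists_pruning`, resting on `three_mul_sq_le_sum`). So about `s` balls
with radii below `s` remove about `3 s² / 4` vertices, which exceeds `n'` once `s² ≈ n`.

The average does not make the chosen radii distinct. Radii are therefore grouped into blocks of
length `L`, and a quadratic potential penalizes overused blocks (`exists_balanced_pruning`), so that
no block is used more than `L` times (`exists_cover`). Moving every ball up one block then gives
distinct radii (`burningNumber_le_of_cover`). -/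

/-! ### The averaging inequality -/

/-- A ball of radius `x` removes `h x + E (h x - 1)` vertices; on average over the radii
`0, …, K` this is at least `3 K / 4`. -/
theorem three_mul_sq_le_sum (h : ℕ → ℕ) (E : ℕ → ℝ) (K : ℕ)
    (h_mono : ∀ x y, x ≤ y → y ≤ K → h x ≤ h y) (E_mono : Monotone E) (E_nonneg : ∀ i, 0 ≤ E i)
    (h_lower : ∀ x ≤ K, x + 1 ≤ h x) (h_upper : ∀ x ≤ K, h x ≤ 2 * x + 1)
    (hE : ∀ x ≤ K, E (h x - 1) + 2 * x + 1 ≤ E (h x) + h x) :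
    (3 / 4 : ℝ) * (K : ℝ) ^ 2 ≤ ∑ x ∈ Finset.range (K + 1), (h x + E (h x - 1)) := by
  -- The term `(K - a) * E (h a)` credits in advance what the side branches met so far contribute to
  -- each larger radius. At `a = K` it vanishes.
  have key : ∀ a ≤ K,
      (a : ℝ) ^ 2 ≤ ∑ x ∈ Finset.range (a + 1), (h x + E (h x - 1)) + (K - a) * E (h a) ∨
      (K : ℝ) * a - (a : ℝ) ^ 2 / 4 ≤
        ∑ x ∈ Finset.range (a + 1), (h x + E (h x - 1)) + (K - a) * E (h a) := by
    intro a
    induction a using Nat.strong_induction_on with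
    | _ a ih =>
      intro haK
      have haK' : (a : ℝ) ≤ K := by exact_mod_cast haK
      rcases Nat.eq_zero_or_pos a with rfl | hapos
      · left
        have h1 : 0 ≤ ∑ x ∈ Finset.range (0 + 1), ((h x : ℝ) + E (h x - 1)) :=
          Finset.sum_nonneg fun x _ => add_nonneg (Nat.cast_nonneg _) (E_nonneg _)
        have h2 : 0 ≤ ((K : ℝ) - (0 : ℕ)) * E (h 0) :=
          mul_nonneg (by simp) (E_nonneg _)
        simp only [Nat.cast_zero] at *
        nlinarith
      -- The induction jumps over the whole interval `(b, a]` on which `h` is constant.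
      · obtain ⟨b, hba, hbh, hconst⟩ : ∃ b < a, h b < h a ∧ ∀ x, b < x → x ≤ a → h x = h a := by
          have h0 : h 0 < h a := by
            have := h_upper 0 (Nat.zero_le _)
            have := h_lower a haK
            omega
          let P : ℕ → Prop := fun b => b < a ∧ h b < h a
          classical
          have hP : P (Nat.findGreatest P a) :=
            Nat.findGreatest_spec (m := 0) (Nat.zero_le _) ⟨hapos, h0⟩
          refine ⟨Nat.findGreatest P a, hP.1, hP.2, fun x hx hxa => ?_⟩
          have hn := Nat.findGreatest_is_greatest hx hxa
          rcases hxa.lt_or_eq with hlt | rfl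
          · have := h_mono x a hxa haK
            by_contra hne
            exact hn ⟨hlt, by omega⟩
          · rfl
        have hba' : (b : ℝ) < a := by exact_mod_cast hba
        have hb0 : (0 : ℝ) ≤ b := Nat.cast_nonneg _
        have hsum : ∑ x ∈ Finset.range (a + 1), ((h x : ℝ) + E (h x - 1)) =
            ∑ x ∈ Finset.range (b + 1), ((h x : ℝ) + E (h x - 1)) +
              (a - b) * (h a + E (h a - 1)) := by
          rw [← Finset.sum_range_add_sum_Ico _ (show b + 1 ≤ a + 1 by omega)]
          congr 1
          rw [Finset.sum_congr rfl (g := fun _ => (h a : ℝ) + E (h a - 1))]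
          · rw [Finset.sum_const, Nat.card_Ico, nsmul_eq_mul]
            congr 1
            rw [Nat.cast_sub (by omega)]
            push_cast
            ring
          · intro x hx
            rw [Finset.mem_Ico] at hx
            rw [hconst x (by omega) (by omega)]
        have h1 := hE a haK
        have h2 : E (h b) ≤ E (h a - 1) := E_mono (by omega)
        have h3 : (a : ℝ) + 1 ≤ h a := by exact_mod_cast h_lower a haK
        have h4 : (h a : ℝ) ≤ 2 * a + 1 := by exact_mod_cast h_upper a haK
        have hIH := ih b hba (by omega)
        rw [hsum]
        set Sb := ∑ x ∈ Finset.range (b + 1), ((h x : ℝ) + E (h x - 1))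
        have hstep : Sb + (K - b) * E (h b) + ((a - b) * h a + (K - a) * (2 * a + 1 - h a)) ≤
            Sb + (a - b) * (h a + E (h a - 1)) + (K - a) * E (h a) := by
          have e1 : (K - a : ℝ) * (E (h a - 1) + 2 * a + 1 - h a) ≤ (K - a) * E (h a) :=
            mul_le_mul_of_nonneg_left (by linarith) (by linarith)
          have e2 : (K - b : ℝ) * E (h b) ≤ (K - b) * E (h a - 1) :=
            mul_le_mul_of_nonneg_left h2 (by linarith)
          nlinarith
        -- The right side is affine in `h a`, so its minimum is at an end of `[a + 1, 2 * a + 1]`;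
        -- the sign of the slope decides which.
        have hgain : (a : ℝ) * (K - b) ≤ (a - b) * h a + (K - a) * (2 * a + 1 - h a) ∨
            2 * (a : ℝ) * (a - b) ≤ (a - b) * h a + (K - a) * (2 * a + 1 - h a) := by
          rcases le_total ((K : ℝ) - a) (a - b) with hc | hc
          · left
            nlinarith [mul_nonneg (sub_nonneg.2 hc) (sub_nonneg.2 h3)]
          · right
            nlinarith [mul_nonneg (sub_nonneg.2 hc) (sub_nonneg.2 h4)]
        set Wb := Sb + (K - b) * E (h b)
        set Wa := Sb + (a - b) * (h a + E (h a - 1)) + (K - a) * E (h a)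
        -- `K b - b² / 4 ≥ b²` exactly when `b ≤ 4 K / 5` (for `b > 0`), so the second bound matters
        -- only for larger `b`.
        have hWb : (b : ℝ) ^ 2 ≤ Wb ∨
            ((K : ℝ) * b - (b : ℝ) ^ 2 / 4 ≤ Wb ∧ 4 / 5 * (K : ℝ) ≤ b) := by
          rcases hIH with h5 | h5
          · exact Or.inl h5
          · rcases le_total (4 / 5 * (K : ℝ)) b with h6 | h6
            · exact Or.inr ⟨h5, h6⟩
            · left
              nlinarith
        rcases hWb with h5 | ⟨h5, h6⟩ <;> rcases hgain with h7 | h7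
        · right
          nlinarith [sq_nonneg ((a : ℝ) / 2 - b)]
        · left
          nlinarith [sq_nonneg ((a : ℝ) - b)]
        · right
          nlinarith [mul_nonneg hb0 (sub_nonneg.2 haK')]
        · right
          nlinarith [mul_nonneg (sub_nonneg.2 hba'.le)
            (show (0 : ℝ) ≤ 2 * a - K + (a + b) / 4 by nlinarith)]
  rcases key K le_rfl with h1 | h1 <;> nlinarith [sq_nonneg (K : ℝ)]

/-! ### Rooted spanning trees and pruning -/

/-- A rooted spanning tree of a graph, given by its parent map and its depth function. -/
structure RootedTree {V : Type*} (G : SimpleGraph V) where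
  root : V
  par : V → V
  dep : V → ℕ
  par_root : par root = root
  dep_root : dep root = 0
  dep_par : ∀ v, v ≠ root → dep (par v) + 1 = dep v
  adj : ∀ v, v ≠ root → G.Adj v (par v)

namespace RootedTree

variable {V : Type*} {G : SimpleGraph V} (B : RootedTree G)

/-- A set of vertices that contains the root and is closed under taking parents. -/
structure IsTop (U : Finset V) : Prop where
  root_mem : B.root ∈ U
  par_mem : ∀ v ∈ U, B.par v ∈ U

theorem dep_par_eq (v : V) : B.dep (B.par v) = B.dep v - 1 := by
  by_cases hv : v = B.root
  · rw [hv, B.par_root, B.dep_root]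
  · have := B.dep_par v hv
    omega

theorem eq_root_of_dep {v : V} (h : B.dep v = 0) : v = B.root := by
  by_contra hv
  have := B.dep_par v hv
  omega

theorem dep_iterate (v : V) (j : ℕ) : B.dep (B.par^[j] v) = B.dep v - j := by
  induction j with
  | zero => rfl
  | succ j ih =>
    rw [Function.iterate_succ_apply', B.dep_par_eq, ih]
    omega

theorem iterate_mem {U : Finset V} (hU : B.IsTop U) {v : V} (hv : v ∈ U) (j : ℕ) :
    B.par^[j] v ∈ U := by
  induction j with
  | zero => exact hv
  | succ j ih =>
    rw [Function.iterate_succ_apply']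
    exact hU.par_mem _ ih

theorem dist_iterate_le (hG : G.Connected) (v : V) (j : ℕ) : G.dist (B.par^[j] v) v ≤ j := by
  induction j with
  | zero => simp
  | succ j ih =>
    rw [Function.iterate_succ_apply']
    set w := B.par^[j] v
    have h1 : G.dist (B.par w) w ≤ 1 := by
      by_cases hw : w = B.root
      · rw [hw, B.par_root]
        simp
      · exact (SimpleGraph.dist_eq_one_iff_adj.2 (B.adj w hw).symm).le
    have := hG.dist_triangle (u := B.par w) (v := w) (w := v)
    omega

variable [DecidableEq V]

/-- The vertices of `U` in the subtree below `w`. -/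
def sub (U : Finset V) (w : V) : Finset V :=
  U.filter fun v => B.dep w ≤ B.dep v ∧ B.par^[B.dep v - B.dep w] v = w

theorem mem_sub {U : Finset V} {v w : V} :
    v ∈ B.sub U w ↔ v ∈ U ∧ B.dep w ≤ B.dep v ∧ B.par^[B.dep v - B.dep w] v = w := by
  simp [sub]

theorem sub_root (U : Finset V) : B.sub U B.root = U := by
  ext v
  rw [mem_sub, B.dep_root]
  refine ⟨fun h => h.1, fun h => ⟨h, Nat.zero_le _, B.eq_root_of_dep ?_⟩⟩
  rw [B.dep_iterate]
  omega

theorem mem_sub_of_par_mem {U : Finset V} {v w : V} (hv : v ∈ U)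
    (h : B.par v ∈ B.sub U w) : v ∈ B.sub U w := by
  by_cases hr : v = B.root
  · rwa [hr, B.par_root, ← hr] at h
  · rw [mem_sub] at h ⊢
    have h1 := B.dep_par v hr
    refine ⟨hv, by omega, ?_⟩
    have h2 : B.dep v - B.dep w = (B.dep (B.par v) - B.dep w) + 1 := by omega
    rw [h2, Function.iterate_succ_apply]
    exact h.2.2

theorem mem_sub_of_iterate_mem {U : Finset V} (hU : B.IsTop U) {v w : V} (hv : v ∈ U) (j : ℕ)
    (h : B.par^[j] v ∈ B.sub U w) : v ∈ B.sub U w := by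
  induction j with
  | zero => exact h
  | succ j ih =>
    rw [Function.iterate_succ_apply'] at h
    exact ih (B.mem_sub_of_par_mem (B.iterate_mem hU hv j) h)

theorem self_mem_sub {U : Finset V} {w : V} (hw : w ∈ U) : w ∈ B.sub U w := by
  simp [mem_sub, hw]

theorem sub_subset_sub_par {U : Finset V} (hU : B.IsTop U) {w : V} (hw : w ∈ U) :
    B.sub U w ⊆ B.sub U (B.par w) := by
  intro v hv
  have h := B.mem_sub.1 hv
  refine B.mem_sub_of_iterate_mem hU h.1 (B.dep v - B.dep w + 1) ?_
  rw [Function.iterate_succ_apply', h.2.2]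
  exact B.self_mem_sub (hU.par_mem _ hw)

theorem isTop_sdiff_sub {U : Finset V} (hU : B.IsTop U) {w : V} (hw : w ≠ B.root) :
    B.IsTop (U \ B.sub U w) := by
  constructor
  · rw [Finset.mem_sdiff]
    refine ⟨hU.root_mem, fun h => hw ?_⟩
    have h1 := (B.mem_sub.1 h).2.1
    rw [B.dep_root] at h1
    exact B.eq_root_of_dep (by omega)
  · intro v hv
    rw [Finset.mem_sdiff] at hv ⊢
    exact ⟨hU.par_mem _ hv.1, fun h => hv.2 (B.mem_sub_of_par_mem hv.1 h)⟩

theorem dist_le_of_mem_sub (hG : G.Connected) {U : Finset V} {v w : V} (h : v ∈ B.sub U w) :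
    G.dist w v + B.dep w ≤ B.dep v := by
  have h1 := B.mem_sub.1 h
  have h2 := B.dist_iterate_le hG v (B.dep v - B.dep w)
  rw [h1.2.2] at h2
  omega

/-- A side branch through `v` at the parent of `w` adds its vertices to the subtree. -/
theorem card_sub_par {U : Finset V} (hU : B.IsTop U) {v w : V} (hw : w ∈ U)
    (hv : v ∈ B.sub U (B.par w)) (hv' : v ∉ B.sub U w) :
    (B.sub U w).card + (B.dep v - B.dep (B.par w) + 1) ≤ (B.sub U (B.par w)).card := by
  set n := B.dep v - B.dep (B.par w)
  have h := B.mem_sub.1 hv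
  have hinj : Set.InjOn (fun j => B.par^[j] v) (Finset.range (n + 1)) := by
    intro i hi j hj hij
    have := congrArg B.dep hij
    simp only [B.dep_iterate] at this
    simp only [Finset.coe_range, Set.mem_Iio] at hi hj
    omega
  -- An ancestor of `v` below `w` would put `v` itself below `w`.
  have hdisj : Disjoint (B.sub U w) ((Finset.range (n + 1)).image fun j => B.par^[j] v) := by
    rw [Finset.disjoint_right]
    intro u hu hu'
    obtain ⟨j, -, rfl⟩ := Finset.mem_image.1 hu
    exact hv' (B.mem_sub_of_iterate_mem hU h.1 j hu')
  have hsub : B.sub U w ∪ (Finset.range (n + 1)).image (fun j => B.par^[j] v) ⊆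
      B.sub U (B.par w) := by
    refine Finset.union_subset (B.sub_subset_sub_par hU hw) fun u hu => ?_
    obtain ⟨j, hj, rfl⟩ := Finset.mem_image.1 hu
    rw [Finset.mem_range] at hj
    refine B.mem_sub_of_iterate_mem hU (B.iterate_mem hU h.1 j) (n - j) ?_
    rw [← Function.iterate_add_apply, show n - j + j = n by omega, h.2.2]
    exact B.self_mem_sub (hU.par_mem _ hw)
  have := Finset.card_le_card hsub
  rwa [Finset.card_union_of_disjoint hdisj, Finset.card_image_of_injOn hinj,
    Finset.card_range] at this

/-- If no ball of radius `K` covers `U`, then for each `x ≤ K` a ball of radius `x` covers some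
pruned part of `U`, and these parts have average size at least `3 K / 4`. -/
theorem exists_pruning (hG : G.Connected) {U : Finset V} (hU : B.IsTop U) (K : ℕ)
    (hfar : ∀ c, ∃ v ∈ U, K < G.dist c v) :
    ∃ W : ℕ → Finset V, (∀ x ≤ K, W x ⊆ U ∧ B.IsTop (W x) ∧
      ∃ c, ∀ v ∈ U \ W x, G.dist c v ≤ x) ∧
      (3 / 4 : ℝ) * (K : ℝ) ^ 2 ≤ ∑ x ∈ Finset.range (K + 1), ((U \ W x).card : ℝ) := by
  -- The spine `p` climbs from a deepest vertex `q`, so everything below `p x` lies within distance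
  -- `x` of it.
  obtain ⟨q, hqU, hq⟩ := U.exists_max_image B.dep ⟨_, hU.root_mem⟩
  set R := B.dep q with hR
  let p : ℕ → V := fun i => B.par^[i] q
  have hpU : ∀ i, p i ∈ U := B.iterate_mem hU hqU
  have hp_succ : ∀ i, p (i + 1) = B.par (p i) := fun i => Function.iterate_succ_apply' _ _ _
  have hp_dep : ∀ i, B.dep (p i) = R - i := B.dep_iterate q
  have hp_root : p R = B.root := B.eq_root_of_dep (by rw [hp_dep]; omega)
  have hp_dist : ∀ i j, i ≤ j → G.dist (p i) (p j) ≤ j - i := by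
    intro i j hij
    have := B.dist_iterate_le hG (p i) (j - i)
    rw [← Function.iterate_add_apply, show j - i + i = j by omega, G.dist_comm] at this
    exact this
  let T : ℕ → Finset V := fun i => B.sub U (p i)
  have hT_mono : Monotone T := monotone_nat_of_le_succ fun i => by
    change B.sub U (p i) ⊆ B.sub U (p (i + 1))
    rw [hp_succ]
    exact B.sub_subset_sub_par hU (hpU i)
  have hT_root : T R = U := by
    change B.sub U (p R) = U
    rw [hp_root, B.sub_root]
  have hT_card : ∀ i v, i + 1 ≤ R → v ∈ T (i + 1) → v ∉ T i →
      (T i).card + B.dep v + i + 2 ≤ (T (i + 1)).card + R := by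
    intro i v hi hv hv'
    have h1 := hp_dep (i + 1)
    have h2 := (B.mem_sub.1 hv).2.1
    change v ∈ B.sub U (p (i + 1)) at hv
    rw [hp_succ] at hv
    have h3 := B.card_sub_par hU (hpU i) hv hv'
    rw [← hp_succ] at h3
    change (T i).card + _ ≤ (T (i + 1)).card at h3
    omega
  have hT_card' : ∀ i, i + 1 ≤ R → (T i).card + 1 ≤ (T (i + 1)).card := by
    intro i hi
    have h1 : p (i + 1) ∈ T (i + 1) := B.self_mem_sub (hpU _)
    have h2 : p (i + 1) ∉ T i := fun h => by
      have := (B.mem_sub.1 h).2.1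
      rw [hp_dep, hp_dep] at this
      omega
    have := hT_card i _ hi h1 h2
    rw [hp_dep] at this
    omega
  have hT_ge : ∀ i ≤ R, i + 1 ≤ (T i).card := by
    intro i
    induction i with
    | zero => exact fun _ => Finset.card_pos.2 ⟨p 0, B.self_mem_sub (hpU 0)⟩
    | succ i ih =>
      intro hi
      have := ih (by omega)
      have := hT_card' i hi
      omega
  -- `v` branches off the spine at `p h`; the route from `p x` up to `p h` and down to `v` has
  -- length `2 * h - x + dep v - R`, and the last condition says that this exceeds `x`.
  let Obs : ℕ → ℕ → Prop := fun x h =>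
    x < h ∧ h ≤ R ∧ ∃ v ∈ T h, v ∉ T (h - 1) ∧ 2 * x + 1 + R ≤ 2 * h + B.dep v
  have hObs_dist : ∀ x i v, x ≤ R → v ∈ T i → i ≤ R → (∀ h ≤ i, ¬ Obs x h) →
      G.dist (p x) v ≤ x := by
    intro x i v hxR
    induction i with
    | zero =>
      intro hv _ _
      have h1 := B.dist_le_of_mem_sub hG (hT_mono (Nat.zero_le x) hv)
      have h2 := hq v (B.mem_sub.1 hv).1
      rw [hp_dep] at h1
      omega
    | succ i ih =>
      intro hv hi hno
      by_cases hv' : v ∈ T i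
      · exact ih hv' (by omega) fun h hh => hno h (by omega)
      · by_cases hix : i + 1 ≤ x
        · have h1 := B.dist_le_of_mem_sub hG (hT_mono hix hv)
          have h2 := hq v (B.mem_sub.1 hv).1
          rw [hp_dep] at h1
          omega
        · have h1 := B.dist_le_of_mem_sub hG hv
          have h2 : ¬ (2 * x + 1 + R ≤ 2 * (i + 1) + B.dep v) := fun h2 =>
            hno (i + 1) le_rfl ⟨by omega, hi, v, hv, hv', h2⟩
          have h3 := hp_dist x (i + 1) (by omega)
          have h4 := hG.dist_triangle (u := p x) (v := p (i + 1)) (w := v)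
          rw [hp_dep] at h1
          omega
  have hKR : K < R := by
    obtain ⟨v, hv, hv'⟩ := hfar B.root
    have h1 := B.dist_le_of_mem_sub hG (U := U) (v := v) (w := B.root) (by rwa [B.sub_root])
    have h2 := hq v hv
    omega
  have hex : ∀ x, ∃ h, x ≤ K → Obs x h := by
    intro x
    by_cases hx : x ≤ K
    · by_contra hno
      push Not at hno
      obtain ⟨v, hv, hv'⟩ := hfar (p x)
      have := hObs_dist x R v (by omega) (by rwa [hT_root]) le_rfl fun h _ => (hno h).2
      omega
    · exact ⟨0, fun h => absurd h hx⟩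
  classical
  let h : ℕ → ℕ := fun x => Nat.find (hex x)
  have hh : ∀ x ≤ K, Obs x (h x) := fun x hx => Nat.find_spec (hex x) hx
  have hmin : ∀ x ≤ K, ∀ i, Obs x i → h x ≤ i := fun x _ i hi => Nat.find_min' (hex x) fun _ => hi
  have hp_mem : ∀ i, i + 1 ≤ R → p (i + 1) ∈ T (i + 1) ∧ p (i + 1) ∉ T i := by
    intro i hi
    refine ⟨B.self_mem_sub (hpU _), fun h => ?_⟩
    have := (B.mem_sub.1 h).2.1
    rw [hp_dep, hp_dep] at this
    omega
  -- `E i` counts the vertices of `T i` off the spine; capping at `R` makes it monotone on all of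
  -- `ℕ`.
  let E : ℕ → ℝ := fun i => ((T (min i R)).card : ℝ) - (min i R : ℕ) - 1
  have hE_of_le : ∀ i ≤ R, E i = (T i).card - i - 1 := by
    intro i hi
    simp only [E, min_eq_left hi]
  have hE_mono : Monotone E := by
    refine monotone_nat_of_le_succ fun i => ?_
    by_cases hi : i + 1 ≤ R
    · rw [hE_of_le _ hi, hE_of_le i (by omega)]
      have : ((T i).card : ℝ) + 1 ≤ (T (i + 1)).card := by exact_mod_cast hT_card' i hi
      push_cast
      linarith
    · simp only [E]
      rw [min_eq_right (by omega), min_eq_right (by omega)]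
  have hE_nonneg : ∀ i, 0 ≤ E i := by
    intro i
    have : ((min i R : ℕ) : ℝ) + 1 ≤ (T (min i R)).card := by
      exact_mod_cast hT_ge _ (min_le_right _ _)
    simp only [E]
    linarith
  have harith := three_mul_sq_le_sum h E K ?_ hE_mono hE_nonneg ?_ ?_ ?_
  · refine ⟨fun x => U \ T (h x - 1), fun x hx => ?_, ?_⟩
    · obtain ⟨h1, h2, -⟩ := hh x hx
      refine ⟨Finset.sdiff_subset, B.isTop_sdiff_sub hU fun h3 => ?_, p x, fun v hv => ?_⟩
      · have := hp_dep (h x - 1)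
        rw [h3, B.dep_root] at this
        omega
      · have hv' : v ∈ T (h x - 1) := by
          rw [Finset.mem_sdiff, Finset.mem_sdiff] at hv
          by_contra h3
          exact hv.2 ⟨hv.1, h3⟩
        refine hObs_dist x (h x - 1) v (by omega) hv' (by omega) fun i hi hobs => ?_
        have := hmin x hx i hobs
        omega
    · refine harith.trans_eq (Finset.sum_congr rfl fun x hx => ?_)
      rw [Finset.mem_range] at hx
      obtain ⟨h1, h2, -⟩ := hh x (by omega)
      have h3 : U \ (U \ T (h x - 1)) = T (h x - 1) :=
        Finset.sdiff_sdiff_eq_self (Finset.filter_subset _ _)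
      rw [h3, hE_of_le _ (by omega), Nat.cast_sub (by omega)]
      push_cast
      ring
  · intro x y hxy hy
    obtain ⟨h1, h2, v, hv, hv', h3⟩ := hh y hy
    exact hmin x (by omega) _ ⟨by omega, h2, v, hv, hv', by omega⟩
  · intro x hx
    exact (hh x hx).1
  · intro x hx
    -- The spine vertex `p (2 * x + 1)` is itself an obstruction.
    by_cases hxR : 2 * x + 1 ≤ R
    · obtain ⟨h1, h2⟩ := hp_mem (2 * x) hxR
      refine hmin x hx _ ⟨by omega, hxR, _, h1, h2, ?_⟩
      rw [hp_dep]
      omega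
    · have := (hh x hx).2.1
      omega
  · intro x hx
    obtain ⟨h1, h2, v, hv, hv', h3⟩ := hh x hx
    rw [hE_of_le _ h2, hE_of_le _ (by omega)]
    have h4 := hT_card (h x - 1) v (by omega) (by rwa [show h x - 1 + 1 = h x by omega]) hv'
    rw [show h x - 1 + 1 = h x by omega] at h4
    have h5 : (T (h x - 1)).card + 2 * x + 1 ≤ (T (h x)).card + (h x - 1) := by omega
    have h6 : ((T (h x - 1)).card : ℝ) + 2 * x + 1 ≤ (T (h x)).card + ((h x - 1 : ℕ) : ℝ) := by
      exact_mod_cast h5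
    linarith

end RootedTree

/-! ### Balanced use of the radius blocks -/

theorem sum_range_mul_div (a : ℕ → ℝ) (M : ℕ) {L : ℕ} (hL : 0 < L) :
    ∑ x ∈ Finset.range (M * L), a (x / L) = L * ∑ g ∈ Finset.range M, a g := by
  induction M with
  | zero => simp
  | succ M ih =>
    rw [add_mul, one_mul, Finset.sum_range_add, ih, Finset.sum_range_succ, mul_add]
    congr 1
    rw [Finset.sum_congr rfl (g := fun _ => a M)]
    · simp
    · intro x hx
      rw [Finset.mem_range] at hx
      rw [mul_comm, Nat.mul_add_div hL, Nat.div_eq_of_lt hx, add_zero]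

namespace RootedTree

variable {V : Type*} {G : SimpleGraph V} (B : RootedTree G) [DecidableEq V]

/-- One can keep pruning `U`, using `u g` balls of radius less than `(g + 1) L` for each `g < M`,
so that the numbers `u g` remain balanced, until what is left is covered by a single ball. -/
theorem exists_balanced_pruning (hG : G.Connected) {U : Finset V} (hU : B.IsTop U) {M L : ℕ}
    (hM : 0 < M) (hL : 0 < L) {lam : ℝ} (hlam : 0 ≤ lam) (t : ℕ) :
    ∃ t₀ ≤ t, ∃ (W : Finset V) (u : ℕ → ℕ) (c : ℕ → ℕ → V), B.IsTop W ∧ W ⊆ U ∧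
      ∑ g ∈ Finset.range M, u g = t₀ ∧
      (∀ v ∈ U \ W, ∃ g < M, ∃ i < u g, G.dist (c g i) v < (g + 1) * L) ∧
      3 / 4 * ((M : ℝ) * L - 2) * t₀ + lam / 2 * (∑ g ∈ Finset.range M, (u g : ℝ) ^ 2 - t₀
        - (t₀ : ℝ) ^ 2 / M) ≤ (U \ W).card ∧
      (t₀ = t ∨ ∃ c, ∀ v ∈ W, G.dist c v < M * L) := by
  induction t with
  | zero =>
    refine ⟨0, le_rfl, U, fun _ => 0, fun _ _ => B.root, hU, subset_rfl, by simp, by simp,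
      by simp, Or.inl rfl⟩
  | succ t ih =>
    obtain ⟨t₀, ht₀, W, u, c, hW, hWU, hu, hcov, hcard, hend⟩ := ih
    by_cases hfin : ∃ c, ∀ v ∈ W, G.dist c v < M * L
    · exact ⟨t₀, by omega, W, u, c, hW, hWU, hu, hcov, hcard, Or.inr hfin⟩
    obtain rfl : t₀ = t := hend.resolve_right hfin
    have hML : 0 < M * L := Nat.mul_pos hM hL
    have hfar : ∀ c, ∃ v ∈ W, M * L - 1 < G.dist c v := by
      intro c
      by_contra hno
      push Not at hno
      exact hfin ⟨c, fun v hv => by have := hno v hv; omega⟩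
    obtain ⟨X, hX, hsum⟩ := B.exists_pruning hG hW (M * L - 1) hfar
    rw [Nat.sub_add_cancel hML, Nat.cast_sub hML] at hsum
    push_cast at hsum
    have hM' : (0 : ℝ) < M := by exact_mod_cast hM
    have hL' : (0 : ℝ) < L := by exact_mod_cast hL
    -- The penalties `lam * (u (x / L) - t₀ / M)` sum to zero over all radii, so some radius does at
    -- least as well as the average; `(M L - 1)² ≥ M L (M L - 2)` gives the constant.
    obtain ⟨x, hx, hxgain⟩ : ∃ x < M * L,
        3 / 4 * ((M : ℝ) * L - 2) + lam * (u (x / L) - t₀ / M) ≤ ((W \ X x).card : ℝ) := by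
      by_contra hno
      push Not at hno
      have h1 := Finset.sum_lt_sum_of_nonempty (s := Finset.range (M * L))
        ⟨0, Finset.mem_range.2 hML⟩ fun x hx => hno x (Finset.mem_range.1 hx)
      rw [sum_range_mul_div (fun g => 3 / 4 * ((M : ℝ) * L - 2) + lam * (u g - t₀ / M)) M hL,
        Finset.sum_add_distrib, ← Finset.mul_sum _ _ lam, Finset.sum_sub_distrib, ← Nat.cast_sum _ u,
        hu] at h1
      simp only [Finset.sum_const, Finset.card_range, nsmul_eq_mul] at h1
      rw [mul_div_cancel₀ _ hM'.ne'] at h1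
      nlinarith
    obtain ⟨hXW, hXtop, a, ha⟩ := hX x (by omega)
    set g := x / L with hg
    have hgM : g < M := Nat.div_lt_of_lt_mul (by rwa [mul_comm])
    have hxg : x < (g + 1) * L := by
      have := Nat.lt_div_mul_add hL (a := x)
      rw [add_mul, one_mul]
      exact this
    have hgr : g ∈ Finset.range M := Finset.mem_range.2 hgM
    refine ⟨t₀ + 1, le_rfl, X x, Function.update u g (u g + 1),
      Function.update c g (Function.update (c g) (u g) a), hXtop, hXW.trans hWU, ?_, ?_, ?_,
      Or.inl rfl⟩
    · rw [Finset.sum_update_of_mem hgr, Finset.sdiff_singleton_eq_erase, ← hu,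
        ← Finset.add_sum_erase _ _ hgr]
      omega
    · intro v hv
      rw [Finset.mem_sdiff] at hv
      by_cases hvW : v ∈ W
      · refine ⟨g, hgM, u g, by simp, ?_⟩
        simp only [Function.update_self]
        exact (ha v (Finset.mem_sdiff.2 ⟨hvW, hv.2⟩)).trans_lt hxg
      · obtain ⟨g', hg', i, hi, hd⟩ := hcov v (Finset.mem_sdiff.2 ⟨hv.1, hvW⟩)
        refine ⟨g', hg', i, ?_, ?_⟩
        · by_cases hgg : g' = g
          · subst hgg
            simp only [Function.update_self]
            omega
          · rwa [Function.update_of_ne hgg]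
        · by_cases hgg : g' = g
          · rw [hgg] at hi hd ⊢
            rwa [Function.update_self, Function.update_of_ne (by omega)]
          · rwa [Function.update_of_ne hgg]
    · have h1 : ((U \ X x).card : ℝ) = (U \ W).card + (W \ X x).card := by
        rw [← Nat.cast_add, ← Finset.card_union_of_disjoint]
        · congr 2
          ext v
          have := @hXW v
          have := @hWU v
          simp only [Finset.mem_union, Finset.mem_sdiff]
          tauto
        · rw [Finset.disjoint_left]
          intro v hv hv'
          exact (Finset.mem_sdiff.1 hv).2 (Finset.mem_sdiff.1 hv').1
      have h2 : ∑ i ∈ Finset.range M, ((Function.update u g (u g + 1) i : ℕ) : ℝ) ^ 2 =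
          ∑ i ∈ Finset.range M, (u i : ℝ) ^ 2 + (2 * u g + 1) := by
        rw [← Finset.add_sum_erase _ _ hgr,
          ← Finset.add_sum_erase _ (fun i => (u i : ℝ) ^ 2) hgr,
          Function.update_self, Finset.sum_congr rfl (g := fun i => (u i : ℝ) ^ 2)]
        · push_cast
          ring
        · intro i hi
          rw [Function.update_of_ne (Finset.ne_of_mem_erase hi)]
      rw [h1, h2]
      push_cast
      have h3 : ((t₀ : ℝ) + 1) ^ 2 / M = (t₀ : ℝ) ^ 2 / M + 2 * (t₀ / M) + 1 / M := by
        field_simp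
        ring
      rw [h3]
      have h4 : 0 ≤ lam * (1 / M) := by positivity
      nlinarith

/-- A top set that is not too large is covered by balls whose radii can be chosen distinct. -/
theorem exists_cover (hG : G.Connected) {U : Finset V} (hU : B.IsTop U) {M L : ℕ}
    (hM : 1 < M) (hL : 0 < L)
    (hcard : (U.card : ℝ) < (M - 1) * L * (3 / 4 * (M * L - 2) - L / 2))
    (hcard' : 2 * (U.card : ℝ) * M ^ 2 ≤ (L : ℝ) ^ 3) :
    ∃ (c : ℕ → ℕ → V) (a : V), ∀ v ∈ U,
      (∃ g < M, ∃ i < L, G.dist (c g i) v < (g + 1) * L) ∨ G.dist a v < M * L := by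
  have hM0 : 0 < M := by omega
  have hM' : (1 : ℝ) < M := by exact_mod_cast hM
  have hM0' : (0 : ℝ) < M := by linarith
  have hL' : (0 : ℝ) < L := by exact_mod_cast hL
  obtain ⟨t, ht, W, u, c, hW, hWU, hu, hcov, hpot, hend⟩ :=
    B.exists_balanced_pruning hG hU hM0 hL hL'.le ((M - 1) * L)
  have ht' : (t : ℝ) ≤ (M - 1) * L := by
    have : (t : ℝ) ≤ ((M - 1) * L : ℕ) := by exact_mod_cast ht
    rwa [Nat.cast_mul, Nat.cast_sub hM0, Nat.cast_one] at this
  have hUW : ((U \ W).card : ℝ) ≤ U.card := by exact_mod_cast Finset.card_le_card Finset.sdiff_subset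
  have hdev : ∑ g ∈ Finset.range M, ((u g : ℝ) - t / M) ^ 2 =
      ∑ g ∈ Finset.range M, (u g : ℝ) ^ 2 - (t : ℝ) ^ 2 / M := by
    have h1 : ∀ g, ((u g : ℝ) - t / M) ^ 2 = (u g : ℝ) ^ 2 - 2 * (t / M) * u g + (t / M) ^ 2 :=
      fun g => by ring
    simp only [h1]
    rw [Finset.sum_add_distrib, Finset.sum_sub_distrib, ← Finset.mul_sum, ← Nat.cast_sum, hu]
    simp only [Finset.sum_const, Finset.card_range, nsmul_eq_mul]
    field_simp
    ring
  have hpos : 0 < 3 / 4 * ((M : ℝ) * L - 2) - L / 2 := by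
    by_contra hneg
    have : (M - 1 : ℝ) * L * (3 / 4 * (M * L - 2) - L / 2) ≤ 0 :=
      mul_nonpos_of_nonneg_of_nonpos (mul_nonneg (by linarith) hL'.le) (not_lt.1 hneg)
    have := Nat.cast_nonneg (α := ℝ) U.card
    linarith
  have hpot' : (3 / 4 * ((M : ℝ) * L - 2) - L / 2) * t +
      L / 2 * ∑ g ∈ Finset.range M, ((u g : ℝ) - t / M) ^ 2 ≤ U.card := by
    rw [hdev]
    linarith
  have hle : ∀ g < M, u g ≤ L := by
    intro g hg
    have h1 := Finset.single_le_sum (f := fun g => ((u g : ℝ) - t / M) ^ 2)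
      (fun g _ => sq_nonneg _) (Finset.mem_range.2 hg)
    have h2 : (L : ℝ) / 2 * ((u g : ℝ) - t / M) ^ 2 ≤ U.card := by
      have := mul_le_mul_of_nonneg_left h1 (by linarith : (0 : ℝ) ≤ L / 2)
      have := mul_nonneg hpos.le (Nat.cast_nonneg (α := ℝ) t)
      linarith
    -- Thus `u g` exceeds the mean `t / M` by at most `L / M`, and `t ≤ (M - 1) L` leaves exactly
    -- this room below `L`.
    have h3 : (((u g : ℝ) - t / M) * M) ^ 2 ≤ (L : ℝ) ^ 2 := by
      have h4 : (L : ℝ) * (((u g : ℝ) - t / M) * M) ^ 2 ≤ L * (L : ℝ) ^ 2 := by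
        have := mul_le_mul_of_nonneg_right h2 (by positivity : (0 : ℝ) ≤ 2 * M ^ 2)
        nlinarith
      exact le_of_mul_le_mul_left h4 hL'
    have h5 := abs_le_of_sq_le_sq' h3 hL'.le
    have h6 : ((u g : ℝ) - t / M) * M = u g * M - t := by
      field_simp
    rw [h6] at h5
    have h7 : (u g : ℝ) * M ≤ L * M := by linarith [h5.2]
    exact_mod_cast le_of_mul_le_mul_right h7 hM0'
  -- Carrying out all `(M - 1) L` steps would remove more vertices than `U` has.
  have hfin : ∃ a, ∀ v ∈ W, G.dist a v < M * L := by
    rcases hend with h | h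
    · exfalso
      have h1 : (t : ℝ) = (M - 1) * L := by
        rw [h, Nat.cast_mul, Nat.cast_sub hM0, Nat.cast_one]
      have h2 : 0 ≤ L / 2 * ∑ g ∈ Finset.range M, ((u g : ℝ) - t / M) ^ 2 :=
        mul_nonneg (by linarith) (Finset.sum_nonneg fun g _ => sq_nonneg _)
      rw [h1] at hpot' h2
      linarith
    · exact h
  obtain ⟨a, ha⟩ := hfin
  refine ⟨c, a, fun v hv => ?_⟩
  by_cases hvW : v ∈ W
  · exact Or.inr (ha v hvW)
  · obtain ⟨g, hg, i, hi, hd⟩ := hcov v (Finset.mem_sdiff.2 ⟨hv, hvW⟩)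
    exact Or.inl ⟨g, hg, i, hi.trans_le (hle g hg), hd⟩

end RootedTree

/-! ### From ball covers to burning -/

section Burning

variable {V : Type*} {G : SimpleGraph V}

theorem exists_adj_dist_add_one (hG : G.Connected) {r v : V} (hv : v ≠ r) :
    ∃ w, G.Adj v w ∧ G.dist r w + 1 = G.dist r v := by
  obtain ⟨p, hp⟩ := hG.exists_walk_length_eq_dist v r
  cases p with
  | nil => exact absurd rfl hv
  | @cons _ w _ h p =>
    refine ⟨w, h, ?_⟩
    have h1 := SimpleGraph.dist_le p
    have h2 := hG.dist_triangle (u := v) (v := w) (w := r)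
    have h3 := SimpleGraph.dist_eq_one_iff_adj.2 h
    rw [SimpleGraph.Walk.length_cons] at hp
    rw [G.dist_comm (u := r), G.dist_comm (u := r)]
    omega

open Classical in
/-- A breadth-first spanning tree. -/
noncomputable def bfsTree (hG : G.Connected) (r : V) : RootedTree G where
  root := r
  par v := if hv : v = r then r else (exists_adj_dist_add_one hG hv).choose
  dep v := G.dist r v
  par_root := by simp
  dep_root := by simp
  dep_par v hv := by
    rw [dif_neg hv]
    exact (exists_adj_dist_add_one hG hv).choose_spec.2
  adj v hv := by
    rw [dif_neg hv]
    exact (exists_adj_dist_add_one hG hv).choose_spec.1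

theorem mem_burned_of_dist (hG : G.Connected) (s : ℕ → V) (i : ℕ) (t : ℕ) :
    ∀ v, G.dist (s i) v + i < t → v ∈ burned G s t := by
  induction t with
  | zero => intro v hv; omega
  | succ t ih =>
    intro v hv
    by_cases hlt : G.dist (s i) v + i < t
    · exact Or.inl (Or.inl (ih v hlt))
    · by_cases hvs : v = s i
      · subst hvs
        have : i = t := by
          rw [SimpleGraph.dist_self] at hv hlt
          omega
        subst this
        exact Or.inr rfl
      · obtain ⟨w, hw, hd⟩ := exists_adj_dist_add_one hG hvs
        exact Or.inl (Or.inr ⟨w, ih w (by omega), hw.symm⟩)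

/-- The `i`-th ball of block `g` gets radius `(g + 1) * L + i`, large enough for every ball of that
block and different for different pairs. The radius `(M + 1) * L` stays free for the last ball `a`.
-/
theorem burningNumber_le_of_cover (hG : G.Connected) {M L b : ℕ} (hL : 0 < L)
    (hb : (M + 1) * L < b) (c : ℕ → ℕ → V) (a : V)
    (hcov : ∀ v, (∃ g < M, ∃ i < L, G.dist (c g i) v ≤ (g + 1) * L) ∨ G.dist a v ≤ M * L) :
    burningNumber G ≤ b := by
  -- `z r` is the centre of the ball of radius `r`, to be lit with `r` rounds still to come. Radii
  -- below `L` are not needed, so their centres are arbitrary.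
  let z : ℕ → V := fun r => if r = (M + 1) * L then a else c (r / L - 1) (r % L)
  have hz : ∀ r < b, ∀ v, G.dist (z r) v ≤ r → v ∈ burned G (fun j => z (b - 1 - j)) b := by
    intro r hr v hv
    refine mem_burned_of_dist hG _ (b - 1 - r) b v ?_
    rw [show b - 1 - (b - 1 - r) = r by omega]
    omega
  refine Nat.sInf_le ⟨fun j => z (b - 1 - j), Set.eq_univ_of_forall fun v => ?_⟩
  rcases hcov v with ⟨g, hg, i, hi, hd⟩ | hd
  · have h1 : (g + 1 + 1) * L ≤ (M + 1) * L := Nat.mul_le_mul_right _ (by omega)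
    rw [add_mul, one_mul] at h1
    refine hz ((g + 1) * L + i) (by omega) v ?_
    have h2 : z ((g + 1) * L + i) = c g i := by
      simp only [z]
      rw [if_neg (by omega), mul_comm, Nat.mul_add_div hL, Nat.div_eq_of_lt hi,
        Nat.mul_add_mod, Nat.mod_eq_of_lt hi]
      rfl
    rw [h2]
    omega
  · refine hz ((M + 1) * L) hb v ?_
    simp only [z, if_true]
    refine hd.trans ?_
    rw [add_mul]
    omega

end Burning

/-! ### Counting and removing leaves -/

section Tree

variable {V : Type*} [Fintype V] {G : SimpleGraph V} [DecidableRel G.Adj]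

theorem card_eq_numNonLeaf_add :
    Fintype.card V = numNonLeaf G + (Finset.univ.filter fun v => G.degree v = 1).card := by
  have h := Finset.card_filter_add_card_filter_not (s := Finset.univ) fun v => G.degree v = 1
  rw [Finset.card_univ] at h
  have h2 : numNonLeaf G = (Finset.univ.filter fun v => ¬ G.degree v = 1).card := rfl
  omega

theorem degree_pos_of_two_le (hG : G.Connected) (h2 : 2 ≤ Fintype.card V) (v : V) :
    0 < G.degree v := by
  have : Nontrivial V := Fintype.one_lt_card_iff_nontrivial.1 h2
  exact hG.preconnected.degree_pos_of_nontrivial v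

theorem sum_degree_sub_three_le (hG : G.IsTree) (h2 : 2 ≤ Fintype.card V) :
    ∑ v, (G.degree v - 3) ≤ (Finset.univ.filter fun v => G.degree v = 1).card := by
  have h1 := G.sum_degrees_eq_twice_card_edges
  have h3 := hG.card_edgeFinset
  -- With truncated subtraction, leaves and vertices of degree `2` give equality; each vertex of
  -- degree at least `3` wastes one.
  have h4 : ∑ v, ((G.degree v - 3) + 2) ≤ ∑ v, (G.degree v + if G.degree v = 1 then 1 else 0) := by
    refine Finset.sum_le_sum fun v _ => ?_
    have := degree_pos_of_two_le hG.connected h2 v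
    split_ifs <;> omega
  rw [Finset.sum_add_distrib, Finset.sum_add_distrib, ← Finset.card_filter] at h4
  simp only [Finset.sum_const, Finset.card_univ, smul_eq_mul] at h4
  omega

theorem excess_mul_numNonLeaf_le (h0 : numNonLeaf G ≠ 0) :
    excess G * numNonLeaf G ≤ ((∑ v, (G.degree v - 3) : ℕ) : ℝ) := by
  have h0' : (numNonLeaf G : ℝ) ≠ 0 := by exact_mod_cast h0
  rw [excess, Finset.sum_mul]
  have h1 : ∀ k ∈ Finset.Ico 4 (Fintype.card V), ((k : ℝ) - 3) * conc G k * numNonLeaf G =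
      ∑ v, if k = G.degree v then ((G.degree v - 3 : ℕ) : ℝ) else 0 := by
    intro k hk
    rw [Finset.mem_Ico] at hk
    rw [conc, mul_assoc, div_mul_cancel₀ _ h0', Finset.card_filter, Nat.cast_sum, Finset.mul_sum]
    refine Finset.sum_congr rfl fun v _ => ?_
    by_cases hv : G.degree v = k
    · rw [if_pos hv, if_pos hv.symm, hv, Nat.cast_sub (by omega)]
      simp
    · rw [if_neg hv, if_neg (Ne.symm hv)]
      simp
  rw [Finset.sum_congr rfl h1, Finset.sum_comm, Nat.cast_sum]
  refine Finset.sum_le_sum fun v _ => ?_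
  rw [Finset.sum_ite_eq']
  split_ifs
  · exact le_rfl
  · exact Nat.cast_nonneg _

theorem concAtLeast_mul_numNonLeaf_le (h0 : numNonLeaf G ≠ 0) {k : ℕ} (hk : 4 ≤ k) :
    concAtLeast G k * ((k : ℝ) - 3) * numNonLeaf G ≤ ((∑ v, (G.degree v - 3) : ℕ) : ℝ) := by
  have h0' : (numNonLeaf G : ℝ) ≠ 0 := by exact_mod_cast h0
  have h1 : (Finset.univ.filter fun v => k ≤ G.degree v).card * (k - 3) ≤
      ∑ v, (G.degree v - 3) := by
    rw [Finset.card_filter, Finset.sum_mul]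
    refine Finset.sum_le_sum fun v _ => ?_
    split_ifs <;> omega
  rw [concAtLeast, mul_right_comm, div_mul_cancel₀ _ h0']
  have h2 : ((k : ℝ) - 3) = ((k - 3 : ℕ) : ℝ) := by
    rw [Nat.cast_sub (by omega)]
    simp
  rw [h2]
  exact_mod_cast h1

/-- Removing the leaves of a tree leaves a top set of a breadth-first tree rooted at a non-leaf. -/
theorem isTop_nonLeaf (hG : G.Connected) {r : V} (hr : G.degree r ≠ 1) :
    (bfsTree hG r).IsTop (Finset.univ.filter fun v => G.degree v ≠ 1) := by
  set B := bfsTree hG r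
  have hroot : B.root = r := rfl
  refine ⟨by simpa [hroot] using hr, fun v hv => ?_⟩
  rw [Finset.mem_filter] at hv ⊢
  refine ⟨Finset.mem_univ _, fun h1 => ?_⟩
  by_cases hvr : v = B.root
  · rw [hvr, B.par_root] at h1
    exact hr h1
  · by_cases hpr : B.par v = B.root
    · rw [hpr] at h1
      exact hr h1
    · obtain ⟨w, hw⟩ := SimpleGraph.degree_eq_one_iff_existsUnique_adj.1 h1
      -- A parent of degree `1` would have its child and its own parent as the same neighbour,
      -- although their depths differ by two.
      have e1 := hw.2 _ (B.adj v hvr).symm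
      have e2 := hw.2 _ (B.adj _ hpr)
      have h2 := B.dep_par v hvr
      have h3 := B.dep_par _ hpr
      rw [e2, ← e1] at h3
      omega

theorem exists_nonLeaf_dist_le_one (hG : G.Connected) {r : V} (hr : G.degree r ≠ 1)
    (v : V) : ∃ w, G.degree w ≠ 1 ∧ G.dist w v ≤ 1 := by
  by_cases hv : G.degree v = 1
  · have hvr : v ≠ r := fun h => hr (h ▸ hv)
    set B := bfsTree hG r
    have hadj := B.adj v hvr
    refine ⟨B.par v, fun h1 => ?_, (SimpleGraph.dist_eq_one_iff_adj.2 hadj.symm).le⟩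
    by_cases hpr : B.par v = B.root
    · rw [hpr] at h1
      exact hr h1
    · obtain ⟨w, hw⟩ := SimpleGraph.degree_eq_one_iff_existsUnique_adj.1 h1
      have e1 := hw.2 _ hadj.symm
      have e2 := hw.2 _ (B.adj _ hpr)
      have h2 := B.dep_par v hvr
      have h3 := B.dep_par _ hpr
      rw [e2, ← e1] at h3
      omega
  · exact ⟨v, hv, by simp⟩

end Tree

/-! ### Parameters and conclusion -/

/-- The numerical conditions under which the covering argument applies. -/
theorem exists_parameters {c : ℝ} (hc : 1 / 3 < c) :
    ∃ M L₀ : ℕ, 1 < M ∧ 0 < L₀ ∧ ∀ L : ℕ, L₀ ≤ L → ∀ m : ℝ, 0 ≤ m →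
      (1 + c) * m ≤ (((M : ℝ) + 1) * (L + 1)) ^ 2 →
      m < ((M : ℝ) - 1) * L * (3 / 4 * (M * L - 2) - L / 2) ∧ 2 * m * M ^ 2 ≤ (L : ℝ) ^ 3 := by
  -- `θ > 0` is the slack in `c > 1/3`; it must absorb the loss of a few blocks out of `M`, hence
  -- `M` of order `8 / θ`.
  set θ := 3 * (1 + c) / 4 - 1 with hθ
  have hθ0 : 0 < θ := by rw [hθ]; linarith
  obtain ⟨M₀, hM₀⟩ := exists_nat_ge (8 / θ)
  set M := M₀ + 3 with hM
  have hM3 : (3 : ℝ) ≤ M := by rw [hM]; push_cast; linarith [Nat.cast_nonneg (α := ℝ) M₀]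
  have hθM : 8 ≤ θ * (M - 1) := by
    rw [div_le_iff₀ hθ0] at hM₀
    rw [hM]
    push_cast
    nlinarith
  -- The coefficient of `L ^ 2` in the first inequality to be proved, after multiplication by `1 +
  -- c`.
  set β := (1 + c) * ((M : ℝ) - 1) * (3 * M / 4 - 1 / 2) - (M + 1) ^ 2 with hβ
  have hβ0 : 0 < β := by
    have h1 : β = (1 + θ) * ((M : ℝ) - 1) * (M - 2 / 3) - (M + 1) ^ 2 := by
      rw [hβ, hθ]
      ring
    rw [h1]
    have h2 := mul_le_mul_of_nonneg_right hθM (by linarith : (0 : ℝ) ≤ M - 1)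
    nlinarith
  obtain ⟨L₁, hL₁⟩ := exists_nat_gt (((1 + c) * ((M : ℝ) - 1) * (3 / 2) + 3 * (M + 1) ^ 2) / β)
  refine ⟨M, L₁ + 8 * M ^ 2 * (M + 1) ^ 2 + 1, by omega, by omega, fun L hL m hm hmL => ?_⟩
  have hL1 : (1 : ℝ) ≤ L := by exact_mod_cast (show 1 ≤ L by omega)
  have hLL₁ : (L₁ : ℝ) ≤ L := by exact_mod_cast (show L₁ ≤ L by omega)
  have hL8 : 8 * (M : ℝ) ^ 2 * (M + 1) ^ 2 ≤ L := by
    exact_mod_cast (show 8 * M ^ 2 * (M + 1) ^ 2 ≤ L by omega)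
  constructor
  · have h1 : (1 + c) * ((M : ℝ) - 1) * (3 / 2) + 3 * (M + 1) ^ 2 < L * β :=
      (div_lt_iff₀ hβ0).1 (hL₁.trans_le hLL₁)
    have h2 : (((M : ℝ) + 1) * (L + 1)) ^ 2 <
        (1 + c) * (((M : ℝ) - 1) * L * (3 / 4 * (M * L - 2) - L / 2)) := by
      have h3 := mul_lt_mul_of_pos_left h1 (by linarith : (0 : ℝ) < L)
      have h4 : 0 ≤ ((M : ℝ) + 1) ^ 2 * (L - 1) := mul_nonneg (sq_nonneg _) (by linarith)
      rw [hβ] at h3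
      nlinarith
    exact lt_of_mul_lt_mul_left (hmL.trans_lt h2) (by linarith)
  · have h1 : m ≤ (((M : ℝ) + 1) * (L + 1)) ^ 2 := by nlinarith
    have h2 : (((M : ℝ) + 1) * (L + 1)) ^ 2 ≤ (M + 1) ^ 2 * (4 * L ^ 2) := by
      rw [mul_pow]
      refine mul_le_mul_of_nonneg_left ?_ (sq_nonneg _)
      nlinarith
    calc 2 * m * M ^ 2 ≤ 2 * ((M + 1) ^ 2 * (4 * L ^ 2)) * M ^ 2 := by gcongr; linarith
      _ = (8 * (M : ℝ) ^ 2 * (M + 1) ^ 2) * L ^ 2 := by ring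
      _ ≤ L * L ^ 2 := by gcongr
      _ = (L : ℝ) ^ 3 := by ring

/-- Connectedness suffices here, since the covering argument uses only a spanning tree and upper
bounds on distances. -/
theorem wellBurnable_of_many_leaves {c : ℝ} (hc : 1 / 3 < c) :
    ∃ N : ℕ, ∀ (V : Type*) [Fintype V] (G : SimpleGraph V) [DecidableRel G.Adj],
      G.Connected → N ≤ numNonLeaf G →
        c * numNonLeaf G ≤ (Finset.univ.filter fun v => G.degree v = 1).card →
        WellBurnable G := by
  obtain ⟨M, L₀, hM, hL₀, hpar⟩ := exists_parameters hc
  refine ⟨((M + 1) * L₀ + 1) ^ 2 + 2, fun V _ G _ hG hN hleaf => ?_⟩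
  classical
  have hcard := card_eq_numNonLeaf_add (G := G)
  set s := ⌈Real.sqrt (Nat.card V)⌉₊ with hs
  have hsn : Fintype.card V ≤ s ^ 2 := by
    have h1 : Real.sqrt (Fintype.card V) ≤ s := by
      rw [← Nat.card_eq_fintype_card]
      exact Nat.le_ceil _
    have h2 := (Real.sqrt_le_left (Nat.cast_nonneg s)).1 h1
    exact_mod_cast h2
  set L := (s - 1) / (M + 1) with hL
  have hs1 : (M + 1) * L₀ + 1 ≤ s := by
    by_contra hlt
    have := Nat.pow_lt_pow_left (not_le.1 hlt) two_ne_zero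
    omega
  have hLL₀ : L₀ ≤ L := by
    rw [hL, Nat.le_div_iff_mul_le (by omega), mul_comm]
    omega
  have hLs : (M + 1) * L < s := by
    have : (M + 1) * L ≤ s - 1 := Nat.mul_div_le _ _
    omega
  have hsL : s ≤ (M + 1) * (L + 1) := by
    have : s - 1 < (M + 1) * (L + 1) := Nat.lt_mul_div_succ _ (by omega)
    omega
  have hm : (1 + c) * (numNonLeaf G : ℝ) ≤ (((M : ℝ) + 1) * (L + 1)) ^ 2 := by
    have h1 : (Fintype.card V : ℝ) ≤ (((M : ℝ) + 1) * (L + 1)) ^ 2 := by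
      exact_mod_cast hsn.trans (Nat.pow_le_pow_left hsL 2)
    rw [hcard] at h1
    push_cast at h1
    linarith
  obtain ⟨h1, h2⟩ := hpar L hLL₀ _ (Nat.cast_nonneg _) hm
  obtain ⟨r, hr⟩ : ∃ r, G.degree r ≠ 1 := by
    have : 0 < numNonLeaf G := by omega
    obtain ⟨r, hr⟩ := Finset.card_pos.1 this
    exact ⟨r, (Finset.mem_filter.1 hr).2⟩
  obtain ⟨z, a, hza⟩ :=
    (bfsTree hG r).exists_cover hG (isTop_nonLeaf hG hr) hM (hL₀.trans_le hLL₀) h1 h2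
  refine burningNumber_le_of_cover hG (hL₀.trans_le hLL₀) hLs z a fun v => ?_
  obtain ⟨w, hw, hwv⟩ := exists_nonLeaf_dist_le_one hG hr v
  rcases hza w (by simpa using hw) with ⟨g, hg, i, hi, hd⟩ | hd
  · refine Or.inl ⟨g, hg, i, hi, ?_⟩
    have := hG.dist_triangle (u := z g i) (v := w) (w := v)
    omega
  · refine Or.inr ?_
    have := hG.dist_triangle (u := a) (v := w) (w := v)
    omega

end GraphBurning

theorem theorem4p4 (c : ℝ) (hc : 1 / 3 < c) :
    ∃ N : ℕ, ∀ (V : Type*) [Fintype V] (G : SimpleGraph V) [DecidableRel G.Adj],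
      G.IsTree → N ≤ GraphBurning.numNonLeaf G →
        (c ≤ GraphBurning.excess G → GraphBurning.WellBurnable G) ∧
        (∀ k : ℕ, 4 ≤ k → c / ((k : ℝ) - 3) ≤ GraphBurning.concAtLeast G k →
          GraphBurning.WellBurnable G) := by
  obtain ⟨N, hN⟩ := GraphBurning.wellBurnable_of_many_leaves hc
  refine ⟨N + 2, fun V _ G _ hG hNG => ?_⟩
  have hcard := GraphBurning.card_eq_numNonLeaf_add (G := G)
  have hsum : ((∑ v, (G.degree v - 3) : ℕ) : ℝ) ≤
      (Finset.univ.filter fun v => G.degree v = 1).card := by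
    exact_mod_cast GraphBurning.sum_degree_sub_three_le hG (by omega)
  have h0 : GraphBurning.numNonLeaf G ≠ 0 := by omega
  have hpos : (0 : ℝ) ≤ GraphBurning.numNonLeaf G := Nat.cast_nonneg _
  refine ⟨fun h => ?_, fun k hk h => ?_⟩
  · refine (hN V G hG.connected (by omega) (le_trans ?_ hsum))
    exact (mul_le_mul_of_nonneg_right h hpos).trans (GraphBurning.excess_mul_numNonLeaf_le h0)
  · refine (hN V G hG.connected (by omega) (le_trans ?_ hsum))
    have hk' : (0 : ℝ) < (k : ℝ) - 3 := by
      have : (4 : ℝ) ≤ k := by exact_mod_cast hk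
      linarith
    rw [div_le_iff₀ hk'] at h
    exact (mul_le_mul_of_nonneg_right h hpos).trans
      (GraphBurning.concAtLeast_mul_numNonLeaf_le h0 hk)
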